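/- Let $V$ and $Q$ be complex Hilbert spaces with $Q \neq \{0\}$, and let $H^*$ denote the space of bounded antilinear functionals on a Hilbert space $H$. Let $A : V \to V^*$ and $B : V \to Q^*$ be bounded linear operators, with sesquilinear forms $a(u,v) = \langle Au, v\rangle$ and $b(v,q) = \langle Bv, q\rangle$, and assume $\ker B \neq \{0\}$. Put $$\|a\| = \sup_{0 \neq u \in V}\ \sup_{0 \neq v \in V} \frac{|a(u,v)|}{\|u\|\,\|v\|},$$ and assume that $$\inf_{0 \neq u \in \ker B}\ \sup_{0 \neq v \in \ker B} \frac{|a(u,v)|}{\|u\|\,\|v\|} = \inf_{0 \neq v \in \ker B}\ \sup_{0 \neq u \in \ker B} \frac{|a(u,v)|}{\|u\|\,\|v\|} =: \alpha > 0, \qquad \inf_{0 \neq q \in Q}\ \sup_{0 \neq v \in V} \frac{|b(v,q)|}{\|v\|\,\|q\|} =: \beta > 0 .$$ On $X = V \times Q$ with norm $\|(u,p)\|_X^2 = \|u\|^2 + \|p\|^2$ consider the form $$\mathcal{B}((u,p),(v,q)) = a(u,v) + \overline{b(v,p)} + b(u,q),$$ that is, the form of the operator $\begin{bmatrix} A &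 B^* \\ B & 0 \end{bmatrix}$. Then for all $f \in V^*$, $g \in Q^*$ the saddle point problem $Au + B^*p = f$, $Bu = g$ has a unique solution $(u,p) \in X$, and $$\gamma := \inf_{0 \neq x \in X}\ \sup_{0 \neq y \in X} \frac{|\mathcal{B}(x,y)|}{\|x\|_X\|y\|_X} = \inf_{0 \neq y \in X}\ \sup_{0 \neq x \in X} \frac{|\mathcal{B}(x,y)|}{\|x\|_X\|y\|_X} .$$ Moreover: (i) The cubic equation $\mu^3 - (\|a\|^2 + \beta^2)\mu + \alpha\beta^2 = 0$ has a smallest positive root $\gamma_{\rm opt}$, and $\gamma \ge \gamma_{\rm opt}$. (ii) For all $f \in V^*$, $g \in Q^*$, the solution $(u,p)$ satisfies, componentwise, $$\begin{bmatrix} \|u\| \\ \|p\| \end{bmatrix} \le D_2 \begin{bmatrix} \|f\|_{V^*} \\ \|g\|_{Q^*} \end{bmatrix}, \qquad D_2 = \begin{bmatrix} \frac{1}{\alpha} & \frac{1}{\beta}\frac{\|a\|}{\alpha} \\ \frac{1}{\beta}\frac{\|a\|}{\alpha} & \frac{\|a\|}{\beta^2}\frac{\|a\|}{\alpha} \end{bmatrix},$$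 where $D_2$ has rank one, and $\gamma \ge \alpha/(1 + \kappa^2)$ with $\kappa = \|a\|/\beta$. -/

import Mathlib

open scoped Matrix

noncomputable section

namespace SaddlePoint

/-- The dual `H*` of a complex Hilbert space `H`: bounded *antilinear* functionals, with the
operator norm. -/
abbrev AntiDual (H : Type*) [NormedAddCommGroup H] [InnerProductSpace ℂ H] : Type _ :=
  H →L⋆[ℂ] ℂ

/-- The norm of a form: `sup_{x ≠ 0} sup_{y ≠ 0} |c(x,y)| / (‖x‖ ‖y‖)`. -/
def formNorm {E F : Type*} [NormedAddCommGroup E] [NormedAddCommGroup F]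
    (c : E → F → ℂ) : ℝ :=
  ⨆ x : {x : E // x ≠ 0}, ⨆ y : {y : F // y ≠ 0}, ‖c x.1 y.1‖ / (‖x.1‖ * ‖y.1‖)

/-- The inf-sup constant of a form: `inf_{x ≠ 0} sup_{y ≠ 0} |c(x,y)| / (‖x‖ ‖y‖)`.
It is used for bounded forms on nonzero spaces only, where the supremum and the infimum are
those of nonempty bounded sets of reals. -/
def infSup {E F : Type*} [NormedAddCommGroup E] [NormedAddCommGroup F]
    (c : E → F → ℂ) : ℝ :=
  ⨅ x : {x : E // x ≠ 0}, ⨆ y : {y : F // y ≠ 0}, ‖c x.1 y.1‖ / (‖x.1‖ * ‖y.1‖)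

variable {V Q : Type*} [NormedAddCommGroup V] [InnerProductSpace ℂ V]
  [NormedAddCommGroup Q] [InnerProductSpace ℂ Q]

/-- The kernel of `B`, as a closed subspace `V₀` of `V`. -/
def kerB (B : V →L[ℂ] AntiDual Q) : Submodule ℂ V :=
  LinearMap.ker (B : V →ₗ[ℂ] AntiDual Q)

/-- The form `𝓑(x,y) = ⟨𝓜 x, y⟩` on `X = V × Q`, for `𝓜 = [A, B*; B, 0]`, where the adjoint is
`⟨B* p, v⟩ = conj ⟨B v, p⟩`. The norm of `X` is `‖(u,p)‖² = ‖u‖² + ‖p‖²`. -/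
def saddleForm (A : V →L[ℂ] AntiDual V) (B : V →L[ℂ] AntiDual Q)
    (x y : WithLp 2 (V × Q)) : ℂ :=
  A x.fst y.fst + (starRingEnd ℂ) (B y.fst x.snd) + B x.fst y.snd

/-- `(u, p)` solves `A u + B* p = f`, `B u = g`, written as a mixed variational problem. -/
def IsSolution (A : V →L[ℂ] AntiDual V) (B : V →L[ℂ] AntiDual Q)
    (f : AntiDual V) (g : AntiDual Q) (u : V) (p : Q) : Prop :=
  (∀ v : V, A u v + (starRingEnd ℂ) (B v p) = f v) ∧ (∀ q : Q, B u q = g q)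

/-- The matrix `D₂` of the componentwise estimate, as a function of `α`, `β` and `‖a‖`. -/
def D₂ (α β na : ℝ) : Matrix (Fin 2) (Fin 2) ℝ :=
  !![1 / α, 1 / β * (na / α);
     1 / β * (na / α), na / β ^ 2 * (na / α)]

end SaddlePoint

end

namespace SaddlePoint

/-! By Riesz, `a` and `b` are represented by operators `T`, `S`, the saddle form by `M = [T, S*; S,
0]`, and an inf-sup constant is the best `m` with `m ‖x‖ ≤ ‖M x‖` for all `x`.

Split `V` into `ker S` and its orthogonal complement, and put `n = ‖a‖`, `s² = n² - α²`. For `u` in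
`ker S`, the component of `T u` in `ker S` has norm at least `α ‖u‖`, while `‖T u‖ ≤ n ‖u‖`;
Pythagoras leaves at most `s ‖u‖` for the other component. The same for `T*` bounds the opposite
off-diagonal block. Moreover `S` on the complement and `S*` on `Q` are bounded below by `β`. Hence
`‖M (u, p)‖` dominates the norm of a symmetric 3 × 3 matrix applied to the signed norms of the
components, enlarged where a residual would be negative (`sq_mul_le`). The cubic is the
characteristic polynomial of that matrix, and its smallest positive root bounds the matrix from
below (`cubic_root_sq_mul_le`).

All hypotheses are symmetric in `T` and `T*`, so `M*` obeys the same bound. Thus `M` is bijective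
and the two inf-sup constants agree. For the componentwise estimate (`norm_solution_le`), `u` is
split into a part in `ker S` driven by `f` and a remainder driven by `g`. -/

/-! ### The cubic, its 3 × 3 matrix, and `D₂` -/

theorem exists_isLeast_cubic_root {α β n : ℝ} (hα : 0 < α) (hβ : 0 < β) (hαn : α ≤ n) :
    ∃ μ : ℝ, IsLeast {μ : ℝ | 0 < μ ∧ μ ^ 3 - (n ^ 2 + β ^ 2) * μ + α * β ^ 2 = 0} μ ∧
      μ ≤ α := by
  set p : ℝ → ℝ := fun μ => μ ^ 3 - (n ^ 2 + β ^ 2) * μ + α * β ^ 2 with hp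
  have hpc : Continuous p := by fun_prop
  have hp0 : 0 < p 0 := by simp only [hp]; ring_nf; positivity
  have hpα : p α ≤ 0 := by
    have : p α = α * (α ^ 2 - n ^ 2) := by simp only [hp]; ring
    rw [this]
    exact mul_nonpos_of_nonneg_of_nonpos hα.le (by nlinarith)
  -- The cubic is positive at `0` and nonpositive at `α`, so it has a zero in `[0, α]`; compactness
  -- of the zero set there provides a least one.
  have hcomp : IsCompact (Set.Icc 0 α ∩ p ⁻¹' {0}) :=
    isCompact_Icc.inter_right (isClosed_singleton.preimage hpc)
  obtain ⟨x, hx, hpx⟩ := intermediate_value_Icc' hα.le hpc.continuousOn ⟨hpα, hp0.le⟩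
  obtain ⟨μ, ⟨hμ, hpμ⟩, hmin⟩ := hcomp.exists_isLeast ⟨x, hx, hpx⟩
  have hpμ : p μ = 0 := hpμ
  have hμ0 : 0 < μ := lt_of_le_of_ne hμ.1 (by rintro rfl; exact hp0.ne' hpμ)
  refine ⟨μ, ⟨⟨hμ0, hpμ⟩, fun ν hν => ?_⟩, hμ.2⟩
  rcases le_total ν α with h | h
  · exact hmin ⟨⟨hν.1.le, h⟩, hν.2⟩
  · exact hμ.2.trans h

/-- The form `‖M y‖² - μ² ‖y‖²` of the matrix `M = [α, s, 0; s, -α, β; 0, β, 0]` at the vector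
`y = (a, -b, -c)` is nonnegative for the smallest positive root `μ` of the characteristic
polynomial of `M`. -/
theorem cubic_root_sq_mul_le {α β n s μ : ℝ} (hβ : 0 < β)
    (hs : s ^ 2 = n ^ 2 - α ^ 2)
    (hμ : IsLeast {μ : ℝ | 0 < μ ∧ μ ^ 3 - (n ^ 2 + β ^ 2) * μ + α * β ^ 2 = 0} μ)
    (hμα : μ ≤ α) (a b c : ℝ) :
    μ ^ 2 * (a ^ 2 + b ^ 2 + c ^ 2) ≤
      (α * a - s * b) ^ 2 + (β * c - (s * a + α * b)) ^ 2 + β ^ 2 * b ^ 2 := by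
  obtain ⟨⟨hμ0, hroot⟩, hmin⟩ := hμ
  rcases hμα.lt_or_eq with hlt | rfl
  -- `D` and `D + β²` are the first two diagonal entries of `M² - μ²`; the root equation and `μ < α`
  -- make them positive.
  · set D := n ^ 2 - μ ^ 2 with hD
    have hDμ : μ * D = β ^ 2 * (α - μ) := by rw [hD]; linarith
    have hEμ : μ * (D + β ^ 2) = α * β ^ 2 := by rw [hD]; linarith
    have hD0 : 0 < D := by
      have : 0 < β ^ 2 * (α - μ) := mul_pos (by positivity) (by linarith)
      rw [← hDμ] at this
      exact (mul_pos_iff_of_pos_left hμ0).1 this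
    have hE0 : 0 < D + β ^ 2 := by positivity
    have hs' : s ^ 2 = D + μ ^ 2 - α ^ 2 := by rw [hs, hD]; ring
    -- The determinant of `M² - μ²` vanishes, so completing the squares in `a` and `b` leaves no
    -- `c²` term.
    have hdet : (β ^ 2 - μ ^ 2) * D * (D + β ^ 2) - s ^ 2 * β ^ 2 * (D + β ^ 2)
        - α ^ 2 * β ^ 2 * D = 0 := by
      have hD' : D = β ^ 2 * (α - μ) / μ := by field_simp; linarith
      rw [hs', hD']
      field_simp
      ring
    have hc : (α * a - s * b) ^ 2 + (β * c - (s * a + α * b)) ^ 2 + β ^ 2 * b ^ 2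
        - μ ^ 2 * (a ^ 2 + b ^ 2 + c ^ 2)
        = D * a ^ 2 + (D + β ^ 2) * b ^ 2 + (β ^ 2 - μ ^ 2) * c ^ 2
          - 2 * s * β * a * c - 2 * α * β * b * c := by
      linear_combination (a ^ 2 + b ^ 2) * hs'
    have hsq : D * (D + β ^ 2) * (D * a ^ 2 + (D + β ^ 2) * b ^ 2 + (β ^ 2 - μ ^ 2) * c ^ 2
          - 2 * s * β * a * c - 2 * α * β * b * c)
        = (D + β ^ 2) * (D * a - s * β * c) ^ 2 + D * ((D + β ^ 2) * b - α * β * c) ^ 2 := by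
      linear_combination c ^ 2 * hdet
    have h1 : 0 ≤ D * (D + β ^ 2) * (D * a ^ 2 + (D + β ^ 2) * b ^ 2 + (β ^ 2 - μ ^ 2) * c ^ 2
          - 2 * s * β * a * c - 2 * α * β * b * c) := by rw [hsq]; positivity
    have h2 := (mul_nonneg_iff_of_pos_left (mul_pos hD0 hE0)).1 h1
    linarith
  -- If `μ = α`, then `n² = α²` and `s = 0`. Minimality is needed only here: the cubic in `ν`
  -- factors as `(ν - μ)(ν² + μν - β²)`, and comparing `μ` with the other positive root `(r - μ) /
  -- 2` gives `2μ² ≤ β²`.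
  · have hn : n ^ 2 = μ ^ 2 := by
      have : μ * (μ ^ 2 - n ^ 2) = 0 := by linarith
      rcases mul_eq_zero.1 this with h | h <;> linarith
    have hs0 : s = 0 := by
      have : s ^ 2 = 0 := by rw [hs, hn]; ring
      exact pow_eq_zero_iff (two_ne_zero) |>.1 this
    subst hs0
    have hβμ : 2 * μ ^ 2 ≤ β ^ 2 := by
      set r := √(μ ^ 2 + 4 * β ^ 2)
      have hr : r ^ 2 = μ ^ 2 + 4 * β ^ 2 := Real.sq_sqrt (by positivity)
      have hrμ : μ < r := Real.lt_sqrt_of_sq_lt (by nlinarith [pow_pos hβ 2])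
      have hle : μ ≤ (r - μ) / 2 := hmin ⟨by linarith, by
        rw [hn]; linear_combination (r - 3 * μ) / 8 * hr⟩
      nlinarith
    nlinarith [sq_nonneg (β * b - μ * c), sq_nonneg c, mul_nonneg (sub_nonneg.2 hβμ) (sq_nonneg c)]

/-- Drop the positive term `μ³` from the root equation. -/
theorem div_le_cubic_root {α β n μ : ℝ} (hβ : 0 < β) (hμ : 0 < μ)
    (hroot : μ ^ 3 - (n ^ 2 + β ^ 2) * μ + α * β ^ 2 = 0) :
    α / (1 + (n / β) ^ 2) ≤ μ := by
  rw [div_le_iff₀ (by positivity)]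
  have : μ * (1 + (n / β) ^ 2) = μ * (n ^ 2 + β ^ 2) / β ^ 2 := by field_simp; ring
  rw [this, le_div_iff₀ (by positivity)]
  nlinarith [pow_pos hμ 3]

theorem rank_D₂ {α β n : ℝ} (hα : 0 < α) : (D₂ α β n).rank = 1 := by
  have h : D₂ α β n = Matrix.vecMulVec ![1 / α, 1 / β * (n / α)] ![1, n / β] := by
    ext i j
    fin_cases i <;> fin_cases j <;> simp [D₂, Matrix.vecMulVec_apply] <;> ring
  refine le_antisymm (h ▸ Matrix.rank_vecMulVec_le _ _) (Nat.one_le_iff_ne_zero.2 fun h0 => ?_)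
  have hr : (D₂ α β n).mulVecLin.range = ⊥ := Submodule.finrank_eq_zero.1 h0
  have h1 : (D₂ α β n *ᵥ ![1, 0]) 0 = 0 := by
    rw [← Matrix.mulVecLin_apply, LinearMap.range_eq_bot.1 hr]; rfl
  have h2 : α⁻¹ = 0 := by simpa [D₂, Matrix.mulVec, dotProduct] using h1
  exact (inv_pos.2 hα).ne' h2

theorem norm_inner_self {E : Type*} [NormedAddCommGroup E] [InnerProductSpace ℂ E] (x : E) :
    ‖(inner ℂ x x : ℂ)‖ = ‖x‖ * ‖x‖ := by
  rw [inner_self_eq_norm_sq_to_K, norm_pow, sq]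
  simp

/-! ### Operators bounded below -/

section BoundedBelow

variable {E F : Type*} [NormedAddCommGroup E] [InnerProductSpace ℂ E] [CompleteSpace E]
  [NormedAddCommGroup F] [InnerProductSpace ℂ F] [CompleteSpace F]

omit [CompleteSpace F] in
theorem isClosed_range_of_bounded_below {M : E →L[ℂ] F} {m : ℝ} (hm : 0 < m)
    (hM : ∀ x, m * ‖x‖ ≤ ‖M x‖) : IsClosed (Set.range M) := by
  have : AntilipschitzWith (Real.toNNReal m⁻¹) M := M.antilipschitz_of_bound fun x => by
    rw [Real.coe_toNNReal _ (inv_pos.2 hm).le, inv_mul_eq_div, le_div_iff₀' hm]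
    exact hM x
  exact this.isClosed_range M.uniformContinuous

/-- The first bound makes the range closed; the second makes its orthogonal complement, the kernel
of the adjoint, trivial. -/
theorem surjective_of_bounded_below {M : E →L[ℂ] F} {m m' : ℝ} (hm : 0 < m) (hm' : 0 < m')
    (hM : ∀ x, m * ‖x‖ ≤ ‖M x‖) (hM' : ∀ y, m' * ‖y‖ ≤ ‖M.adjoint y‖) :
    Function.Surjective M := by
  have hcl : IsClosed (M.range : Set F) := isClosed_range_of_bounded_below hm hM
  have hbot : M.rangeᗮ = ⊥ := by
    rw [M.orthogonal_range, LinearMap.ker_eq_bot']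
    intro y hy
    have h := hM' y
    have hy : M.adjoint y = 0 := hy
    rw [hy, norm_zero] at h
    exact norm_le_zero_iff.1 (nonpos_of_mul_nonpos_right h hm')
  have htop : M.range.topologicalClosure = ⊤ :=
    (Submodule.topologicalClosure_eq_top_iff).2 hbot
  rw [IsClosed.submodule_topologicalClosure_eq hcl] at htop
  exact LinearMap.range_eq_top.1 htop

omit [CompleteSpace E] [CompleteSpace F] in
theorem injective_of_bounded_below {M : E →L[ℂ] F} {m : ℝ} (hm : 0 < m)
    (hM : ∀ x, m * ‖x‖ ≤ ‖M x‖) : Function.Injective M := by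
  refine (injective_iff_map_eq_zero M).2 fun x hx => ?_
  have h := hM x
  rw [hx, norm_zero] at h
  exact norm_le_zero_iff.1 (nonpos_of_mul_nonpos_right h hm)

/-- With `y = M x`, Cauchy–Schwarz gives `‖M x‖² ≤ ‖M* M x‖ ‖x‖`. Keeping the same constant `m` is
what makes the two inf-sup constants equal. -/
theorem adjoint_bounded_below {M : E →L[ℂ] F} {m : ℝ} (hm : 0 < m)
    (hM : ∀ x, m * ‖x‖ ≤ ‖M x‖) (hsurj : Function.Surjective M) (y : F) :
    m * ‖y‖ ≤ ‖M.adjoint y‖ := by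
  obtain ⟨x, rfl⟩ := hsurj y
  rcases eq_or_ne (M x) 0 with h | h
  · simp [h]
  · have h1 : ‖M x‖ * ‖M x‖ ≤ ‖M.adjoint (M x)‖ * ‖x‖ := by
      rw [← norm_inner_self, ← ContinuousLinearMap.adjoint_inner_left]
      exact norm_inner_le_norm _ _
    have h2 := mul_le_mul_of_nonneg_left (hM x) (norm_nonneg (M.adjoint (M x)))
    have h3 : 0 < ‖M x‖ := norm_pos_iff.2 h
    refine le_of_mul_le_mul_right ?_ h3
    nlinarith

/-- If `S*` is bounded below, then so is `S` on the orthogonal complement of its kernel. -/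
theorem le_norm_apply_of_mem_ker_orthogonal {S : E →L[ℂ] F} {β : ℝ} (hβ : 0 < β)
    (hS : ∀ q, β * ‖q‖ ≤ ‖S.adjoint q‖) {u : E} (hu : u ∈ S.kerᗮ) :
    β * ‖u‖ ≤ ‖S u‖ := by
  -- The complement of `ker S` is the closure of the range of `S*`, which is already closed, so `u =
  -- S* q`.
  have hcl : IsClosed (S.adjoint.range : Set E) := isClosed_range_of_bounded_below hβ hS
  rw [S.orthogonal_ker, hcl.submodule_topologicalClosure_eq] at hu
  obtain ⟨q, rfl⟩ := hu
  change β * ‖S.adjoint q‖ ≤ ‖S (S.adjoint q)‖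
  rcases eq_or_ne q 0 with rfl | h
  · simp
  · have h1 : ‖S.adjoint q‖ * ‖S.adjoint q‖ ≤ ‖S (S.adjoint q)‖ * ‖q‖ := by
      rw [← norm_inner_self, ContinuousLinearMap.adjoint_inner_right]
      exact norm_inner_le_norm _ _
    have h2 := mul_le_mul_of_nonneg_left (hS q) (norm_nonneg (S.adjoint q))
    have h3 : 0 < ‖q‖ := norm_pos_iff.2 h
    have h4 := mul_le_mul_of_nonneg_left h1 hβ.le
    have h5 := mul_le_mul_of_nonneg_left (hS q) (norm_nonneg (S (S.adjoint q)))
    have h6 : 0 < ‖S.adjoint q‖ := lt_of_lt_of_le (mul_pos hβ h3) (hS q)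
    refine le_of_mul_le_mul_right ?_ h6
    nlinarith

end BoundedBelow

/-! ### Inf-sup constants as lower bounds of operators -/

section InfSup

variable {E F H : Type*} [NormedAddCommGroup E] [NormedAddCommGroup F]
  [NormedAddCommGroup H] [InnerProductSpace ℂ H]

theorem infSup_congr {c d : E → F → ℂ} (h : ∀ x y, ‖c x y‖ = ‖d x y‖) :
    infSup c = infSup d := by
  simp only [infSup, h]

theorem iSup_norm_inner_div {w : H} {x : E} (hx : x ≠ 0) [Nontrivial H] :
    ⨆ y : {y : H // y ≠ 0}, ‖inner ℂ y.1 w‖ / (‖x‖ * ‖y.1‖) = ‖w‖ / ‖x‖ := by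
  have hx' : 0 < ‖x‖ := norm_pos_iff.2 hx
  have hle : ∀ y : {y : H // y ≠ 0}, ‖inner ℂ y.1 w‖ / (‖x‖ * ‖y.1‖) ≤ ‖w‖ / ‖x‖ := fun y => by
    have hy : 0 < ‖y.1‖ := norm_pos_iff.2 y.2
    rw [div_le_div_iff₀ (by positivity) hx']
    nlinarith [norm_inner_le_norm (𝕜 := ℂ) y.1 w]
  refine le_antisymm (Real.iSup_le hle (by positivity)) ?_
  rcases eq_or_ne w 0 with rfl | hw
  · simp
  · refine le_ciSup_of_le ⟨_, Set.forall_mem_range.2 hle⟩ ⟨w, hw⟩ ?_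
    have hw' : 0 < ‖w‖ := norm_pos_iff.2 hw
    simp only [norm_inner_self]
    apply le_of_eq
    field_simp

/-- The inner supremum is `‖M x‖ / ‖x‖`, attained at `y = M x` when this is nonzero. -/
theorem le_infSup_inner_iff [Nontrivial E] [Nontrivial H] (M : E → H) (h0 : M 0 = 0) {m : ℝ} :
    m ≤ infSup (fun x y => inner ℂ y (M x)) ↔ ∀ x, m * ‖x‖ ≤ ‖M x‖ := by
  have heq : infSup (fun x y => inner ℂ y (M x)) =
      ⨅ x : {x : E // x ≠ 0}, ‖M x.1‖ / ‖x.1‖ := by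
    unfold infSup
    exact iInf_congr fun x => iSup_norm_inner_div x.2
  obtain ⟨x₀, hx₀⟩ := exists_ne (0 : E)
  have : Nonempty {x : E // x ≠ 0} := ⟨⟨x₀, hx₀⟩⟩
  rw [heq, le_ciInf_iff ⟨0, Set.forall_mem_range.2 fun x => by positivity⟩]
  constructor
  · intro h x
    rcases eq_or_ne x 0 with rfl | hx
    · simp [h0]
    · exact (le_div_iff₀ (norm_pos_iff.2 hx)).1 (h ⟨x, hx⟩)
  · exact fun h x => (le_div_iff₀ (norm_pos_iff.2 x.2)).2 (h x.1)

end InfSup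

/-! ### Riesz representation of functionals and forms -/

section Riesz

variable {E H : Type*} [NormedAddCommGroup E] [InnerProductSpace ℂ E]
  [NormedAddCommGroup H] [InnerProductSpace ℂ H] [CompleteSpace H]

theorem exists_inner_eq_antiDual (f : AntiDual H) :
    ∃ w : H, (∀ v, f v = inner ℂ v w) ∧ ‖w‖ = ‖f‖ := by
  -- Conjugation turns the antilinear `f` into a linear functional.
  let φ : H →L[ℂ] ℂ := LinearMap.mkContinuous
    { toFun := fun v => (starRingEnd ℂ) (f v)
      map_add' := fun x y => by simp
      map_smul' := fun c x => by simp } ‖f‖ fun x => by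
        simpa using f.le_opNorm x
  have hφ : ∀ v, f v = inner ℂ v ((InnerProductSpace.toDual ℂ H).symm φ) := fun v => by
    rw [← inner_conj_symm, InnerProductSpace.toDual_symm_apply]
    simp [φ]
  refine ⟨_, hφ, le_antisymm ?_ ?_⟩
  · rw [LinearIsometryEquiv.norm_map]
    exact LinearMap.mkContinuous_norm_le _ (norm_nonneg _) _
  · refine f.opNorm_le_bound (norm_nonneg _) fun v => ?_
    rw [hφ, mul_comm]
    exact norm_inner_le_norm _ _

theorem exists_inner_eq_operator (A : E →L[ℂ] AntiDual H) :
    ∃ T : E →L[ℂ] H, ∀ u v, A u v = inner ℂ v (T u) := by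
  choose T hT hTn using fun u => exists_inner_eq_antiDual (A u)
  refine ⟨LinearMap.mkContinuous
    { toFun := T
      map_add' := fun x y => ext_inner_left ℂ fun v => by
        rw [inner_add_right, ← hT, ← hT, ← hT]; simp
      map_smul' := fun c x => ext_inner_left ℂ fun v => by
        rw [RingHom.id_apply, inner_smul_right, ← hT, ← hT]; simp } ‖A‖ fun x => ?_, fun u v => hT u v⟩
  exact (hTn x).le.trans (A.le_opNorm x)

omit [CompleteSpace H] in
theorem norm_le_formNorm_mul (T : E →L[ℂ] H) (u : E) :
    ‖T u‖ ≤ formNorm (fun (u : E) (v : H) => inner ℂ v (T u)) * ‖u‖ := by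
  -- If `T u = 0`, nonnegativity of the form norm suffices, even when a supremum is over an empty
  -- set and defaults to `0`; otherwise both spaces are nonzero.
  rcases eq_or_ne (T u) 0 with h | h
  · rw [h, norm_zero]
    refine mul_nonneg (Real.iSup_nonneg fun x => Real.iSup_nonneg fun y => ?_) (norm_nonneg _)
    positivity
  have hu : u ≠ 0 := by rintro rfl; simp at h
  have : Nontrivial H := ⟨⟨_, _, h⟩⟩
  rw [← div_le_iff₀ (norm_pos_iff.2 hu)]
  have heq : formNorm (fun (u : E) (v : H) => inner ℂ v (T u)) =
      ⨆ x : {x : E // x ≠ 0}, ‖T x.1‖ / ‖x.1‖ := by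
    unfold formNorm
    exact iSup_congr fun x => iSup_norm_inner_div x.2
  rw [heq]
  refine le_ciSup (f := fun x : {x : E // x ≠ 0} => ‖T x.1‖ / ‖x.1‖)
    ⟨‖T‖, Set.forall_mem_range.2 fun x => ?_⟩ ⟨u, hu⟩
  exact (div_le_iff₀ (norm_pos_iff.2 x.2)).2 (T.le_opNorm _)

end Riesz

/-! ### Estimates in the splitting of `V` by `ker S` -/

variable {V Q : Type*} [NormedAddCommGroup V] [InnerProductSpace ℂ V] [CompleteSpace V]
  [NormedAddCommGroup Q] [InnerProductSpace ℂ Q] [CompleteSpace Q]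

/-- The stability conditions for the operator `[T, S*; S, 0]`, with constants `α`, `β` and a bound
`n` for the norm of `T`. -/
structure IsStable (T : V →L[ℂ] V) (S : V →L[ℂ] Q) (α β n : ℝ) : Prop where
  α_pos : 0 < α
  β_pos : 0 < β
  α_le : α ≤ n
  norm_le : ∀ u, ‖T u‖ ≤ n * ‖u‖
  le_proj : ∀ u ∈ S.ker, α * ‖u‖ ≤ ‖S.ker.starProjection (T u)‖
  le_proj_adjoint : ∀ u ∈ S.ker, α * ‖u‖ ≤ ‖S.ker.starProjection (T.adjoint u)‖
  le_adjoint : ∀ q, β * ‖q‖ ≤ ‖S.adjoint q‖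

namespace IsStable

variable {T : V →L[ℂ] V} {S : V →L[ℂ] Q} {α β n : ℝ}

theorem n_pos (h : IsStable T S α β n) : 0 < n := h.α_pos.trans_le h.α_le

theorem adjoint (h : IsStable T S α β n) : IsStable T.adjoint S α β n where
  α_pos := h.α_pos
  β_pos := h.β_pos
  α_le := h.α_le
  norm_le u := by
    have h1 : ‖T.adjoint‖ ≤ n := by
      rw [LinearIsometryEquiv.norm_map]
      exact T.opNorm_le_bound h.n_pos.le h.norm_le
    exact T.adjoint.le_of_opNorm_le h1 u
  le_proj := h.le_proj_adjoint
  le_proj_adjoint := by simpa using h.le_proj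
  le_adjoint := h.le_adjoint

theorem sq_sqrt (h : IsStable T S α β n) : √(n ^ 2 - α ^ 2) ^ 2 = n ^ 2 - α ^ 2 :=
  Real.sq_sqrt (by nlinarith [h.α_pos, h.α_le])

theorem norm_proj_sq_add_le (h : IsStable T S α β n) (u : V) :
    ‖S.ker.starProjection (T u)‖ ^ 2 + ‖S.kerᗮ.starProjection (T u)‖ ^ 2 ≤ n ^ 2 * ‖u‖ ^ 2 := by
  rw [← Submodule.norm_sq_eq_add_norm_sq_starProjection, ← mul_pow]
  exact pow_le_pow_left₀ (norm_nonneg _) (h.norm_le u) 2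

theorem norm_proj_orthogonal_le (h : IsStable T S α β n) {u : V} (hu : u ∈ S.ker) :
    ‖S.kerᗮ.starProjection (T u)‖ ≤ √(n ^ 2 - α ^ 2) * ‖u‖ := by
  refine (abs_le_of_sq_le_sq' ?_ (by positivity)).2
  have h1 := h.norm_proj_sq_add_le u
  have h2 := pow_le_pow_left₀ (mul_nonneg h.α_pos.le (norm_nonneg _)) (h.le_proj u hu) 2
  rw [mul_pow, h.sq_sqrt]
  rw [mul_pow] at h2
  linarith

/-- This block is the adjoint of the block of `T*` from `ker S` to its complement, to which
`norm_proj_orthogonal_le` applies. -/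
theorem norm_proj_le (h : IsStable T S α β n) {u : V} (hu : u ∈ S.kerᗮ) :
    ‖S.ker.starProjection (T u)‖ ≤ √(n ^ 2 - α ^ 2) * ‖u‖ := by
  set z := S.ker.starProjection (T u) with hz
  have hzK : z ∈ S.ker := Submodule.starProjection_apply_mem _ _
  rcases eq_or_ne z 0 with h0 | h0
  · rw [h0, norm_zero]; positivity
  refine le_of_mul_le_mul_right ?_ (norm_pos_iff.2 h0)
  have hzz : (inner ℂ z z : ℂ) = inner ℂ (T u) z := by
    conv_lhs => rw [hz, Submodule.inner_starProjection_left_eq_right, ← hz]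
    rw [Submodule.starProjection_eq_self_iff.2 hzK]
  calc ‖z‖ * ‖z‖ = ‖(inner ℂ z z : ℂ)‖ := (norm_inner_self z).symm
    _ = ‖(inner ℂ (S.kerᗮ.starProjection (T.adjoint z)) u : ℂ)‖ := by
        rw [Submodule.inner_starProjection_left_eq_right S.kerᗮ,
          Submodule.starProjection_eq_self_iff.2 hu, ContinuousLinearMap.adjoint_inner_left, hzz,
          norm_inner_symm]
    _ ≤ ‖S.kerᗮ.starProjection (T.adjoint z)‖ * ‖u‖ := norm_inner_le_norm _ _
    _ ≤ √(n ^ 2 - α ^ 2) * ‖z‖ * ‖u‖ := by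
        gcongr
        exact h.adjoint.norm_proj_orthogonal_le hzK
    _ = √(n ^ 2 - α ^ 2) * ‖u‖ * ‖z‖ := by ring

theorem adjoint_apply_mem (S : V →L[ℂ] Q) (p : Q) : S.adjoint p ∈ S.kerᗮ := by
  rw [S.orthogonal_ker]
  exact Submodule.le_topologicalClosure _ ⟨p, rfl⟩

theorem proj_adjoint_apply (S : V →L[ℂ] Q) (p : Q) : S.ker.starProjection (S.adjoint p) = 0 :=
  (Submodule.starProjection_apply_eq_zero_iff _).2 (adjoint_apply_mem S p)

omit [CompleteSpace Q] in
theorem apply_proj_orthogonal (S : V →L[ℂ] Q) (u : V) : S (S.kerᗮ.starProjection u) = S u := by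
  have h1 : S (S.ker.starProjection u) = 0 := Submodule.starProjection_apply_mem S.ker u
  conv_rhs => rw [← S.ker.starProjection_add_starProjection_orthogonal u, map_add, h1, zero_add]

theorem le_norm_apply (h : IsStable T S α β n) (u : V) :
    β * ‖S.kerᗮ.starProjection u‖ ≤ ‖S u‖ := by
  rw [← apply_proj_orthogonal S u]
  exact le_norm_apply_of_mem_ker_orthogonal h.β_pos h.le_adjoint
    (Submodule.starProjection_apply_mem _ _)

theorem sub_le_norm_proj (h : IsStable T S α β n) (u : V) :
    α * ‖S.ker.starProjection u‖ - √(n ^ 2 - α ^ 2) * ‖S.kerᗮ.starProjection u‖ ≤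
      ‖S.ker.starProjection (T u)‖ := by
  have h1 := h.le_proj _ (Submodule.starProjection_apply_mem S.ker u)
  have h2 := h.norm_proj_le (Submodule.starProjection_apply_mem S.kerᗮ u)
  have h3 : S.ker.starProjection (T u) = S.ker.starProjection (T (S.ker.starProjection u)) +
      S.ker.starProjection (T (S.kerᗮ.starProjection u)) := by
    rw [← map_add, ← map_add, Submodule.starProjection_add_starProjection_orthogonal]
  rw [h3]
  have h4 := norm_sub_le_norm_add (S.ker.starProjection (T (S.ker.starProjection u)))
    (S.ker.starProjection (T (S.kerᗮ.starProjection u)))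
  linarith

theorem sq_mul_le (h : IsStable T S α β n) {μ : ℝ}
    (hμ : ∀ a b c : ℝ, μ ^ 2 * (a ^ 2 + b ^ 2 + c ^ 2) ≤
      (α * a - √(n ^ 2 - α ^ 2) * b) ^ 2 + (β * c - (√(n ^ 2 - α ^ 2) * a + α * b)) ^ 2
        + β ^ 2 * b ^ 2)
    (u : V) (p : Q) :
    μ ^ 2 * (‖u‖ ^ 2 + ‖p‖ ^ 2) ≤ ‖T u + S.adjoint p‖ ^ 2 + ‖S u‖ ^ 2 := by
  set s := √(n ^ 2 - α ^ 2) with hs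
  have hs0 : 0 ≤ s := Real.sqrt_nonneg _
  have hs2 : s ^ 2 = n ^ 2 - α ^ 2 := h.sq_sqrt
  have hα := h.α_pos
  have hβ := h.β_pos
  set a := ‖S.ker.starProjection u‖ with ha
  set b := ‖S.kerᗮ.starProjection u‖ with hb
  have hu : ‖u‖ ^ 2 = a ^ 2 + b ^ 2 := Submodule.norm_sq_eq_add_norm_sq_starProjection u S.ker
  set t := ‖S.ker.starProjection (T u)‖ with ht
  set w := ‖S.kerᗮ.starProjection (T u)‖ with hw
  set r := ‖S.kerᗮ.starProjection (T u) + S.adjoint p‖ with hr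
  have ha0 : 0 ≤ a := norm_nonneg _
  have hb0 : 0 ≤ b := norm_nonneg _
  have ht0 : 0 ≤ t := norm_nonneg _
  have hw0 : 0 ≤ w := norm_nonneg _
  have hr0 : 0 ≤ r := norm_nonneg _
  have hf : ‖T u + S.adjoint p‖ ^ 2 = t ^ 2 + r ^ 2 := by
    rw [Submodule.norm_sq_eq_add_norm_sq_starProjection _ S.ker, map_add, map_add,
      proj_adjoint_apply, add_zero,
      Submodule.starProjection_eq_self_iff.2 (adjoint_apply_mem S p)]
  have htab : α * a - s * b ≤ t := h.sub_le_norm_proj u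
  have htw : t ^ 2 + w ^ 2 ≤ n ^ 2 * (a ^ 2 + b ^ 2) := hu ▸ h.norm_proj_sq_add_le u
  have hrp : β * ‖p‖ - w ≤ r := by
    have h1 := norm_sub_le_norm_add (S.adjoint p) (S.kerᗮ.starProjection (T u))
    rw [add_comm (S.adjoint p)] at h1
    have h2 := h.le_adjoint p
    linarith
  have hSu : β * b ≤ ‖S u‖ := h.le_norm_apply u
  have hSu2 : β ^ 2 * b ^ 2 ≤ ‖S u‖ ^ 2 := by
    rw [← mul_pow]; exact pow_le_pow_left₀ (by positivity) hSu 2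
  -- Enlarging `a` and `c` to the values at which both residuals are nonnegative.
  set a' := max a (s * b / α) with ha'
  set w' := s * a' + α * b with hw'
  set c' := max ‖p‖ (w' / β) with hc'
  have haa' : a ≤ a' := le_max_left _ _
  have hw'0 : 0 ≤ w' := by have := ha0.trans haa'; positivity
  have ht' : 0 ≤ α * a' - s * b := by
    have : s * b / α ≤ a' := le_max_right _ _
    rw [div_le_iff₀ hα] at this
    linarith
  have htt' : α * a' - s * b ≤ t := by
    rcases max_choice a (s * b / α) with hc | hc
    · rw [ha', hc]; exact htab
    · rw [ha', hc, mul_div_cancel₀ _ hα.ne']; linarith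
  -- The matrix `[α, -s; s, α]` is `n` times a rotation, so the norm bound on `T u` together with `α
  -- a' - s b ≤ t` forces `w ≤ w'`.
  have hn : n ^ 2 * (a' ^ 2 + b ^ 2) = (α * a' - s * b) ^ 2 + w' ^ 2 := by
    rw [hw']; linear_combination -(a' ^ 2 + b ^ 2) * hs2
  have hww' : w ≤ w' := by
    refine (abs_le_of_sq_le_sq' ?_ hw'0).2
    have h1 : n ^ 2 * (a ^ 2 + b ^ 2) ≤ n ^ 2 * (a' ^ 2 + b ^ 2) := by gcongr
    have h2 : (α * a' - s * b) ^ 2 ≤ t ^ 2 := pow_le_pow_left₀ ht' htt' 2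
    linarith
  have hc'0 : 0 ≤ β * c' - w' := by
    have : w' / β ≤ c' := le_max_right _ _
    rw [div_le_iff₀ hβ] at this
    linarith
  have hrc' : β * c' - w' ≤ r := by
    rcases max_choice ‖p‖ (w' / β) with hc | hc
    · rw [hc', hc]; linarith
    · rw [hc', hc, mul_div_cancel₀ _ hβ.ne']; linarith
  have hpc' : ‖p‖ ≤ c' := le_max_left _ _
  calc μ ^ 2 * (‖u‖ ^ 2 + ‖p‖ ^ 2) ≤ μ ^ 2 * (a' ^ 2 + b ^ 2 + c' ^ 2) := by rw [hu]; gcongr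
    _ ≤ (α * a' - s * b) ^ 2 + (β * c' - w') ^ 2 + β ^ 2 * b ^ 2 := hμ a' b c'
    _ ≤ t ^ 2 + r ^ 2 + ‖S u‖ ^ 2 := by gcongr
    _ = _ := by rw [hf]

theorem exists_mem_ker_proj_eq (h : IsStable T S α β n) (w : V) :
    ∃ u ∈ S.ker, S.ker.starProjection (T u) = S.ker.starProjection w := by
  let T₀ : S.ker →L[ℂ] S.ker := S.ker.orthogonalProjectionOnto ∘L T ∘L S.ker.subtypeL
  have hadj : T₀.adjoint = S.ker.orthogonalProjectionOnto ∘L T.adjoint ∘L S.ker.subtypeL := by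
    simp only [T₀, ContinuousLinearMap.adjoint_comp, Submodule.adjoint_subtypeL,
      Submodule.adjoint_orthogonalProjectionOnto]
    rfl
  have hsurj : Function.Surjective T₀ :=
    surjective_of_bounded_below h.α_pos h.α_pos (fun x => h.le_proj x x.2)
      (fun x => by rw [hadj]; exact h.le_proj_adjoint x x.2)
  obtain ⟨u, hu⟩ := hsurj (S.ker.orthogonalProjectionOnto w)
  exact ⟨u, u.2, congrArg Subtype.val hu⟩

theorem norm_solution_le (h : IsStable T S α β n) {u w : V} {p r : Q}
    (hw : T u + S.adjoint p = w) (hr : S u = r) :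
    ‖u‖ ≤ 1 / α * ‖w‖ + 1 / β * (n / α) * ‖r‖ ∧
      ‖p‖ ≤ 1 / β * (n / α) * ‖w‖ + n / β ^ 2 * (n / α) * ‖r‖ := by
  set s := √(n ^ 2 - α ^ 2) with hs
  have hs0 : 0 ≤ s := Real.sqrt_nonneg _
  have hs2 : s ^ 2 = n ^ 2 - α ^ 2 := h.sq_sqrt
  have hα := h.α_pos
  have hβ := h.β_pos
  have hn := h.n_pos
  -- `uf` absorbs the component of `w` in `ker S`; the remainder `u - uf` then satisfies a problem
  -- with no load on `ker S`.
  obtain ⟨uf, hufK, huf⟩ := h.exists_mem_ker_proj_eq w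
  set x := ‖S.ker.starProjection w‖ with hx
  set y := ‖S.kerᗮ.starProjection w‖ with hy
  have hxy : ‖w‖ ^ 2 = x ^ 2 + y ^ 2 := Submodule.norm_sq_eq_add_norm_sq_starProjection w S.ker
  have hx0 : 0 ≤ x := norm_nonneg _
  have hy0 : 0 ≤ y := norm_nonneg _
  have hxw : x ≤ ‖w‖ := (abs_le_of_sq_le_sq' (by nlinarith) (norm_nonneg _)).2
  have hufx : α * ‖uf‖ ≤ x := by rw [hx, ← huf]; exact h.le_proj uf hufK
  have hpT : S.ker.starProjection (T (u - uf)) = 0 := by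
    rw [map_sub, map_sub, huf, ← hw, map_add, proj_adjoint_apply, add_zero, sub_self]
  have hSug : S (u - uf) = r := by
    have : S uf = 0 := hufK
    rw [map_sub, this, sub_zero, hr]
  set ug := u - uf with hug
  have hb := h.le_norm_apply ug
  have ha := h.sub_le_norm_proj ug
  rw [hpT, norm_zero] at ha
  rw [hSug] at hb
  have hugsq := Submodule.norm_sq_eq_add_norm_sq_starProjection ug S.ker
  set a := ‖S.ker.starProjection ug‖ with ha_def
  set b := ‖S.kerᗮ.starProjection ug‖ with hb_def
  have ha0 : 0 ≤ a := norm_nonneg _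
  have hb0 : 0 ≤ b := norm_nonneg _
  -- From `α a ≤ s b` one gets `α² (a² + b²) ≤ (s² + α²) b² = n² b²`.
  have hugb : α * ‖ug‖ ≤ n * b := by
    refine (abs_le_of_sq_le_sq' ?_ (by positivity)).2
    have h1 : (α * a) ^ 2 ≤ (s * b) ^ 2 := pow_le_pow_left₀ (by positivity) (by linarith) 2
    rw [mul_pow, hugsq]
    rw [mul_pow, mul_pow, hs2] at h1
    linarith
  have hugr : ‖ug‖ ≤ 1 / β * (n / α) * ‖r‖ := by
    have h1 : b ≤ ‖r‖ / β := (le_div_iff₀' hβ).2 hb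
    calc ‖ug‖ ≤ n * b / α := (le_div_iff₀' hα).2 hugb
      _ ≤ n * (‖r‖ / β) / α := by gcongr
      _ = _ := by ring
  have hu : u = uf + ug := by rw [hug]; abel
  refine ⟨?_, ?_⟩
  · have h1 : ‖uf‖ ≤ 1 / α * ‖w‖ := by
      rw [one_div_mul_eq_div, le_div_iff₀' hα]; linarith
    calc ‖u‖ ≤ ‖uf‖ + ‖ug‖ := hu ▸ norm_add_le _ _
      _ ≤ _ := add_le_add h1 hugr
  · set z := ‖S.kerᗮ.starProjection (T uf)‖ with hz
    have hz0 : 0 ≤ z := norm_nonneg _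
    have hzx : α * z ≤ s * x := by
      refine (mul_le_mul_of_nonneg_left (h.norm_proj_orthogonal_le hufK) hα.le).trans ?_
      rw [← hs]
      nlinarith
    have hyz : α * (y + z) ≤ n * ‖w‖ := by
      -- Cauchy–Schwarz for `(α, s)` and `(y, x)`, with `α² + s² = n²`; this yields the factor `n /
      -- α` where bounding `y` and `z` separately would lose.
      have h1 : α * y + s * x ≤ n * ‖w‖ := by
        refine (abs_le_of_sq_le_sq' ?_ (by positivity)).2
        rw [mul_pow n, hxy]
        nlinarith [sq_nonneg (α * x - s * y)]
      linarith
    have hSp : S.adjoint p = S.kerᗮ.starProjection w - S.kerᗮ.starProjection (T uf)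
        - S.kerᗮ.starProjection (T ug) := by
      rw [← hw, sub_sub, ← map_add, ← map_add, ← hu, map_add, add_sub_cancel_left,
        Submodule.starProjection_eq_self_iff.2 (adjoint_apply_mem S p)]
    have hTug : ‖S.kerᗮ.starProjection (T ug)‖ ≤ n * ‖ug‖ :=
      (Submodule.norm_starProjection_apply_le _ _).trans (h.norm_le ug)
    have hp : β * ‖p‖ ≤ n * ‖w‖ / α + n * (1 / β * (n / α) * ‖r‖) := by
      calc β * ‖p‖ ≤ ‖S.adjoint p‖ := h.le_adjoint p
        _ ≤ y + z + n * ‖ug‖ := by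
          rw [hSp]
          exact (norm_sub_le _ _).trans (add_le_add (norm_sub_le _ _) hTug)
        _ ≤ _ := by
          gcongr
          exact (le_div_iff₀' hα).2 hyz
    calc ‖p‖ ≤ (n * ‖w‖ / α + n * (1 / β * (n / α) * ‖r‖)) / β := (le_div_iff₀' hβ).2 hp
      _ = _ := by ring

end IsStable

/-! ### The block operator on the product space -/

/-- The operator `[T, S*; S, 0]` on `V × Q`. -/
noncomputable def saddleOp (T : V →L[ℂ] V) (S : V →L[ℂ] Q) :
    WithLp 2 (V × Q) →L[ℂ] WithLp 2 (V × Q) :=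
  ((WithLp.prodContinuousLinearEquiv 2 ℂ V Q).symm : V × Q →L[ℂ] WithLp 2 (V × Q)) ∘L
    ((T ∘L ContinuousLinearMap.fst ℂ V Q + S.adjoint ∘L ContinuousLinearMap.snd ℂ V Q).prod
      (S ∘L ContinuousLinearMap.fst ℂ V Q)) ∘L
    (WithLp.prodContinuousLinearEquiv 2 ℂ V Q : WithLp 2 (V × Q) →L[ℂ] V × Q)

theorem saddleOp_apply (T : V →L[ℂ] V) (S : V →L[ℂ] Q) (x : WithLp 2 (V × Q)) :
    saddleOp T S x = WithLp.toLp 2 (T x.fst + S.adjoint x.snd, S x.fst) := rfl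

theorem saddleOp_adjoint (T : V →L[ℂ] V) (S : V →L[ℂ] Q) :
    (saddleOp T S).adjoint = saddleOp T.adjoint S := by
  refine ((ContinuousLinearMap.eq_adjoint_iff _ _).2 fun x y => ?_).symm
  simp only [saddleOp_apply, WithLp.prod_inner_apply, inner_add_left, inner_add_right,
    ContinuousLinearMap.adjoint_inner_left, ContinuousLinearMap.adjoint_inner_right]
  change _ = inner ℂ x.fst (T y.fst) + inner ℂ (S x.fst) y.snd + inner ℂ x.snd (S y.fst)
  change inner ℂ x.fst (T y.fst) + inner ℂ x.snd (S y.fst) + inner ℂ (S x.fst) y.snd = _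
  ring

theorem saddleForm_eq_inner {A : V →L[ℂ] AntiDual V} {B : V →L[ℂ] AntiDual Q}
    {T : V →L[ℂ] V} {S : V →L[ℂ] Q} (hT : ∀ u v, A u v = inner ℂ v (T u))
    (hS : ∀ v q, B v q = inner ℂ q (S v)) (x y : WithLp 2 (V × Q)) :
    saddleForm A B x y = inner ℂ y (saddleOp T S x) := by
  rw [saddleForm, hT, hS, hS, inner_conj_symm, saddleOp_apply, WithLp.prod_inner_apply,
    inner_add_right, ContinuousLinearMap.adjoint_inner_right]
  rfl

theorem isSolution_iff {A : V →L[ℂ] AntiDual V} {B : V →L[ℂ] AntiDual Q}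
    {T : V →L[ℂ] V} {S : V →L[ℂ] Q} (hT : ∀ u v, A u v = inner ℂ v (T u))
    (hS : ∀ v q, B v q = inner ℂ q (S v)) {f : AntiDual V} {g : AntiDual Q} {w : V} {r : Q}
    (hw : ∀ v, f v = inner ℂ v w) (hr : ∀ q, g q = inner ℂ q r) (u : V) (p : Q) :
    IsSolution A B f g u p ↔ T u + S.adjoint p = w ∧ S u = r := by
  simp only [IsSolution, hT, hS, hw, hr, inner_conj_symm,
    ← ContinuousLinearMap.adjoint_inner_right, ← inner_add_right]
  exact and_congr ⟨ext_inner_left ℂ, fun h v => by rw [h]⟩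
    ⟨ext_inner_left ℂ, fun h v => by rw [h]⟩

theorem IsStable.saddleOp_bounded_below {T : V →L[ℂ] V} {S : V →L[ℂ] Q} {α β n μ : ℝ}
    (h : IsStable T S α β n)
    (hμ : IsLeast {μ : ℝ | 0 < μ ∧ μ ^ 3 - (n ^ 2 + β ^ 2) * μ + α * β ^ 2 = 0} μ)
    (hμα : μ ≤ α) (x : WithLp 2 (V × Q)) : μ * ‖x‖ ≤ ‖saddleOp T S x‖ := by
  refine (abs_le_of_sq_le_sq' ?_ (norm_nonneg _)).2
  rw [mul_pow, WithLp.prod_norm_sq_eq_of_L2, WithLp.prod_norm_sq_eq_of_L2]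
  exact h.sq_mul_le (cubic_root_sq_mul_le h.β_pos h.sq_sqrt hμ hμα) x.fst x.snd

/-- The inf-sup constant on a subspace `K` is a lower bound for the compression to `K` of the
operator that represents the form. -/
theorem infSup_mul_le_norm_proj {H : Type*} [NormedAddCommGroup H] [InnerProductSpace ℂ H]
    {K : Submodule ℂ H} [K.HasOrthogonalProjection] (hK : K ≠ ⊥) (T : H →L[ℂ] H)
    {c : K → K → ℂ} (hc : ∀ u v, ‖c u v‖ = ‖(inner ℂ (v : H) (T u) : ℂ)‖) {u : H} (hu : u ∈ K) :
    infSup c * ‖u‖ ≤ ‖K.starProjection (T u)‖ := by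
  have : Nontrivial K := Submodule.nontrivial_iff_ne_bot.2 hK
  have heq : infSup c = infSup fun u v : K => inner ℂ v (K.orthogonalProjectionOnto (T u)) :=
    infSup_congr fun u v => by
      rw [hc, Submodule.coe_inner, ← Submodule.starProjection_apply,
        ← Submodule.inner_starProjection_left_eq_right,
        Submodule.starProjection_eq_self_iff.2 v.2]
  exact (le_infSup_inner_iff (fun u : K => K.orthogonalProjectionOnto (T u)) (by simp)).1 heq.le
    ⟨u, hu⟩

theorem kerB_eq_ker {V Q : Type*} [NormedAddCommGroup V] [InnerProductSpace ℂ V]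
    [NormedAddCommGroup Q] [InnerProductSpace ℂ Q] {B : V →L[ℂ] AntiDual Q} {S : V →L[ℂ] Q}
    (hS : ∀ v q, B v q = inner ℂ q (S v)) : kerB B = S.ker := by
  ext v
  change B v = 0 ↔ S v = 0
  constructor
  · intro h
    refine ext_inner_left ℂ fun q => ?_
    rw [← hS, h, inner_zero_right]; rfl
  · intro h
    ext q
    rw [hS, h, inner_zero_right]; rfl

end SaddlePoint

/-! ### The main theorem -/

theorem theorem1 {V Q : Type*}
    [NormedAddCommGroup V] [InnerProductSpace ℂ V] [CompleteSpace V]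
    [NormedAddCommGroup Q] [InnerProductSpace ℂ Q] [CompleteSpace Q] [Nontrivial Q]
    (A : V →L[ℂ] SaddlePoint.AntiDual V) (B : V →L[ℂ] SaddlePoint.AntiDual Q)
    (hker : SaddlePoint.kerB B ≠ ⊥)
    (na α β γ : ℝ)
    -- `na` is the norm of the form `a(u,v) = ⟨A u, v⟩`
    (hna : na = SaddlePoint.formNorm (fun u v : V => A u v))
    -- `α` is the common value of the two inf-sup constants of `a` on `ker B`
    (hα : α = SaddlePoint.infSup (fun u v : SaddlePoint.kerB B => A (u : V) (v : V)))
    (hα' : α = SaddlePoint.infSup (fun v u : SaddlePoint.kerB B => A (u : V) (v : V)))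
    (hαpos : 0 < α)
    -- `β` is the inf-sup constant of `b(v,q) = ⟨B v, q⟩`
    (hβ : β = SaddlePoint.infSup (fun (q : Q) (v : V) => B v q))
    (hβpos : 0 < β)
    -- `γ` is the inf-sup constant of the form on the product space
    (hγ : γ = SaddlePoint.infSup (SaddlePoint.saddleForm A B)) :
    -- `γ` is well defined: both inf-sup constants agree
    γ = SaddlePoint.infSup
        (fun y x : WithLp 2 (V × Q) => SaddlePoint.saddleForm A B x y) ∧
    -- (i)
    (∃ γopt : ℝ,
      IsLeast {μ : ℝ | 0 < μ ∧ μ ^ 3 - (na ^ 2 + β ^ 2) * μ + α * β ^ 2 = 0} γopt ∧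
      γopt ≤ γ) ∧
    -- (ii)
    (∀ (f : SaddlePoint.AntiDual V) (g : SaddlePoint.AntiDual Q),
      (∃! x : V × Q, SaddlePoint.IsSolution A B f g x.1 x.2) ∧
      ∀ (u : V) (p : Q), SaddlePoint.IsSolution A B f g u p →
        ![‖u‖, ‖p‖] ≤ SaddlePoint.D₂ α β na *ᵥ ![‖f‖, ‖g‖]) ∧
    (SaddlePoint.D₂ α β na).rank = 1 ∧
    α / (1 + (na / β) ^ 2) ≤ γ := by
  open SaddlePoint in
  obtain ⟨T, hT⟩ := exists_inner_eq_operator A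
  obtain ⟨S, hS⟩ := exists_inner_eq_operator B
  have hB : kerB B = S.ker := kerB_eq_ker hS
  rw [hB] at hα hα' hker
  obtain ⟨v₀, hv₀, hv₀0⟩ := (Submodule.ne_bot_iff _).1 hker
  have : Nontrivial V := ⟨⟨_, _, hv₀0⟩⟩
  have : Nontrivial (WithLp 2 (V × Q)) := (WithLp.equiv 2 (V × Q)).nontrivial
  have hnorm : ∀ u, ‖T u‖ ≤ na * ‖u‖ := fun u => by
    rw [hna]
    simp only [hT]
    exact norm_le_formNorm_mul T u
  have hproj : ∀ u ∈ S.ker, α * ‖u‖ ≤ ‖S.ker.starProjection (T u)‖ := fun u hu => by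
    rw [hα]
    exact infSup_mul_le_norm_proj (c := fun u v : S.ker => A (u : V) (v : V)) hker T (fun u v => by rw [hT]) hu
  have hproj' : ∀ u ∈ S.ker, α * ‖u‖ ≤ ‖S.ker.starProjection (T.adjoint u)‖ := fun u hu => by
    rw [hα']
    exact infSup_mul_le_norm_proj (c := fun v u : S.ker => A (u : V) (v : V)) hker T.adjoint
      (fun u v => by rw [hT, ContinuousLinearMap.adjoint_inner_right, norm_inner_symm]) hu
  have hst : IsStable T S α β na :=
    { α_pos := hαpos
      β_pos := hβpos
      -- A nonzero vector of the kernel compares the lower bound `α` with the upper bound `na`.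
      α_le := by
        refine le_of_mul_le_mul_right ?_ (norm_pos_iff.2 hv₀0)
        exact (hproj v₀ hv₀).trans
          ((Submodule.norm_starProjection_apply_le _ _).trans (hnorm v₀))
      norm_le := hnorm
      le_proj := hproj
      le_proj_adjoint := hproj'
      le_adjoint := by
        refine (le_infSup_inner_iff S.adjoint (map_zero _)).1 (hβ.le.trans (le_of_eq ?_))
        exact infSup_congr fun q v => by
          rw [hS, ContinuousLinearMap.adjoint_inner_right, norm_inner_symm] }
  obtain ⟨μ, hμ, hμα⟩ := exists_isLeast_cubic_root hαpos hβpos hst.α_le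
  have hM := hst.saddleOp_bounded_below hμ hμα
  have hM' := hst.adjoint.saddleOp_bounded_below hμ hμα
  rw [← saddleOp_adjoint] at hM'
  have hsurj : Function.Surjective (saddleOp T S) :=
    surjective_of_bounded_below hμ.1.1 hμ.1.1 hM hM'
  have hsurj' : Function.Surjective (saddleOp T S).adjoint :=
    surjective_of_bounded_below hμ.1.1 hμ.1.1 hM' (by simpa using hM)
  have hγ₁ : γ = infSup fun x y => inner ℂ y (saddleOp T S x) :=
    hγ.trans (infSup_congr fun x y => by rw [saddleForm_eq_inner hT hS])
  have hγ₂ : infSup (fun y x : WithLp 2 (V × Q) => saddleForm A B x y) =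
      infSup fun y x => inner ℂ x ((saddleOp T S).adjoint y) :=
    infSup_congr fun y x => by
      rw [saddleForm_eq_inner hT hS, ContinuousLinearMap.adjoint_inner_right, norm_inner_symm]
  have hμγ : μ ≤ γ := hγ₁ ▸ (le_infSup_inner_iff _ (map_zero _)).2 hM
  refine ⟨?_, ⟨μ, hμ, hμγ⟩, fun f g => ?_, rank_D₂ hαpos,
    (div_le_cubic_root hβpos hμ.1.1 hμ.1.2).trans hμγ⟩
  · rw [hγ₂]
    -- Each of the operator and its adjoint is surjective and bounded below, so the best constant of
    -- either one is a lower bound for the other.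
    refine le_antisymm ?_ ?_
    · rw [le_infSup_inner_iff _ (map_zero _)]
      exact adjoint_bounded_below (hμ.1.1.trans_le hμγ)
        ((le_infSup_inner_iff _ (map_zero _)).1 hγ₁.le) hsurj
    · have hle := (le_infSup_inner_iff (saddleOp T S).adjoint (map_zero _)).2 hM'
      have h := adjoint_bounded_below (hμ.1.1.trans_le hle)
        ((le_infSup_inner_iff (saddleOp T S).adjoint (map_zero _)).1 le_rfl) hsurj'
      rw [ContinuousLinearMap.adjoint_adjoint] at h
      exact ((le_infSup_inner_iff _ (map_zero _)).2 h).trans hγ₁.ge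
  · obtain ⟨w, hw, hwf⟩ := exists_inner_eq_antiDual f
    obtain ⟨r, hr, hrg⟩ := exists_inner_eq_antiDual g
    have hiff := isSolution_iff hT hS hw hr
    refine ⟨?_, fun u p hup => ?_⟩
    · obtain ⟨x, hx⟩ := hsurj (WithLp.toLp 2 (w, r))
      have hx' : T x.fst + S.adjoint x.snd = w ∧ S x.fst = r := by
        simpa [saddleOp_apply] using hx
      refine ⟨(x.fst, x.snd), (hiff _ _).2 hx', fun y hy => ?_⟩
      obtain ⟨h1, h2⟩ := (hiff _ _).1 hy
      have hy' : saddleOp T S (WithLp.toLp 2 y) = saddleOp T S x := by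
        rw [hx, saddleOp_apply, ← h1, ← h2]
        rfl
      exact congrArg WithLp.ofLp (injective_of_bounded_below hμ.1.1 hM hy')
    · obtain ⟨h1, h2⟩ := (hiff u p).1 hup
      have h := hst.norm_solution_le h1 h2
      rw [hwf, hrg] at h
      intro i
      fin_cases i
      · simpa [D₂, Matrix.mulVec, dotProduct] using h.1
      · simpa [D₂, Matrix.mulVec, dotProduct] using h.2
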